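/- For $\alpha\in(1,2)$, $\sigma>0$ and $\beta\in[-1,1]$, call a real random variable $X$ $\alpha$-stable with scale $\sigma$ and skewness $\beta$ if $$\mathbb{E}\,e^{itX}=\exp\Bigl(-\sigma^{\alpha}|t|^{\alpha}\bigl(1-i\beta\,\mathrm{sign}(t)\tan(\pi\alpha/2)\bigr)\Bigr)\qquad(t\in\mathbb{R});$$ the standard symmetric $\alpha$-stable variables, with $\mathbb{E}\,e^{itX}=e^{-|t|^{\alpha}}$, are the case $\sigma=1$, $\beta=0$. Let $1<p<q<2$. There are constants $c,C>0$ depending only on $p$ and $q$ such that the following holds. Let $\xi_1,\dots,\xi_n$ be independent, identically distributed $q$-stable random variables with scale $\sigma$ and skewness $\beta$ on a probability space $(\Omega_1,\mathfrak{A}_1,\mathbb{P}_1)$, and let $\eta_1,\dots,\eta_m$ be independent, identically distributed $p$-stable random variables with scale $\tau$ and skewness $\gamma$ on a probability space $(\Omega_2,\mathfrak{A}_2,\mathbb{P}_2)$. Then for all $(a_{ij})\in\mathbb{R}^{n\times m}$ the iterated expectation below is finite and $$c\,\sigma\tau\,\Bigl(\sum_{j=1}^m\Bigl(\sum_{i=1}^n|a_{ij}|^q\Bigr)^{p/q}\Bigr)^{1/p}\;\le\;\mathbb{E}_{\Omega_1}\mathbb{E}_{\Omega_2}\max_{i,j}\bigl|a_{ij}\,\eta_j(\omega_2)\,\xi_i(\omega_1)\bigr|\;\le\;C\,\sigma\tau\,\Bigl(\sum_{j=1}^m\Bigl(\sum_{i=1}^n|a_{ij}|^q\Bigr)^{p/q}\Bigr)^{1/p}.$$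 -/

import Mathlib

open MeasureTheory ProbabilityTheory

/-- The law `ν` on `ℝ` is strictly stable of index `α` (`α ≠ 1`) with scale `σ > 0` and skewness
`β ∈ [-1, 1]`, i.e. its characteristic function is
`exp (-(σ |t|) ^ α (1 - i β sign t tan (π α / 2)))`.
The symmetric laws, with characteristic function `exp (-(σ |t|) ^ α)`, are the case `β = 0`. -/
def IsStableLaw (α σ β : ℝ) (ν : Measure ℝ) : Prop :=
  0 < σ ∧ |β| ≤ 1 ∧
    ∀ t : ℝ, charFun ν t =
      Complex.exp (-(((σ * |t|) ^ α : ℝ) : ℂ) *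
        (1 - Complex.I * ((β * Real.sign t * Real.tan (Real.pi * α / 2) : ℝ) : ℂ)))

/-- The `ℓ_r`-norm of a finite family of reals. -/
noncomputable def ellNorm {ι : Type*} [Fintype ι] (r : ℝ) (x : ι → ℝ) : ℝ :=
  ‖WithLp.toLp (ENNReal.ofReal r) x‖

/-- `max_{i,j} |a_{ij} y_j x_i|`; it is `0` for an empty index set. -/
noncomputable def maxAbs {n m : ℕ} (a : Matrix (Fin n) (Fin m) ℝ) (x : Fin n → ℝ)
    (y : Fin m → ℝ) : ℝ :=
  ⨆ ij : Fin n × Fin m, |a ij.1 ij.2 * y ij.2 * x ij.1|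

/-- The `r`-th moment of a truncated function with tails of order `α < r`. -/
lemma lintegral_min_rpow_le {Ω : Type*} [MeasurableSpace Ω] {μ : Measure Ω} {f : Ω → ℝ}
    {K α r δ : ℝ} (hf : Measurable f) (hf0 : 0 ≤ f) (hK : 0 ≤ K) (hα : 0 < α) (hr : α < r)
    (hδ : 0 < δ) (htail : ∀ t > 0, μ {x | t < f x} ≤ ENNReal.ofReal (K * t ^ (-α))) :
    ∫⁻ x, ENNReal.ofReal (min (f x) δ ^ r) ∂μ ≤
      ENNReal.ofReal (r * K / (r - α) * δ ^ (r - α)) := by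
  have hr0 : 0 < r := hα.trans hr
  rw [lintegral_rpow_eq_lintegral_meas_lt_mul μ
    (Filter.Eventually.of_forall fun x => le_min (hf0 x) hδ.le)
    (hf.min measurable_const).aemeasurable hr0]
  have hint : IntegrableOn (fun t : ℝ => K * t ^ (r - 1 - α)) (Set.Ioc 0 δ) := by
    rw [← intervalIntegrable_iff_integrableOn_Ioc_of_le hδ.le]
    exact (intervalIntegral.intervalIntegrable_rpow' (by linarith)).const_mul K
  have hval : ∫ t in Set.Ioc 0 δ, K * t ^ (r - 1 - α) = K / (r - α) * δ ^ (r - α) := by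
    rw [← intervalIntegral.integral_of_le hδ.le, intervalIntegral.integral_const_mul,
      integral_rpow (Or.inl (by linarith))]
    rw [Real.zero_rpow (by linarith : r - 1 - α + 1 ≠ 0), show r - 1 - α + 1 = r - α by ring]
    ring
  have hle : ∫⁻ t in Set.Ioi 0, μ {a | t < min (f a) δ} * ENNReal.ofReal (t ^ (r - 1)) ≤
      ∫⁻ t in Set.Ioc 0 δ, ENNReal.ofReal (K * t ^ (r - 1 - α)) := by
    rw [← lintegral_indicator measurableSet_Ioi, ← lintegral_indicator measurableSet_Ioc]
    refine lintegral_mono fun t => ?_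
    by_cases ht : 0 < t
    · by_cases htδ : t ≤ δ
      · rw [Set.indicator_of_mem (Set.mem_Ioi.2 ht), Set.indicator_of_mem (Set.mem_Ioc.2 ⟨ht, htδ⟩)]
        calc μ {a | t < min (f a) δ} * ENNReal.ofReal (t ^ (r - 1))
            ≤ ENNReal.ofReal (K * t ^ (-α)) * ENNReal.ofReal (t ^ (r - 1)) := by
              gcongr
              refine le_trans (measure_mono fun a (ha : t < min (f a) δ) => ?_) (htail t ht)
              exact (lt_min_iff.1 ha).1
          _ = ENNReal.ofReal (K * t ^ (r - 1 - α)) := by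
              rw [← ENNReal.ofReal_mul (by positivity), mul_assoc, ← Real.rpow_add ht]
              ring_nf
      · have : {a | t < min (f a) δ} = ∅ := by
          refine Set.eq_empty_of_forall_notMem fun a (ha : t < min (f a) δ) => ?_
          exact htδ (lt_min_iff.1 ha).2.le
        rw [Set.indicator_of_mem (Set.mem_Ioi.2 ht), this, measure_empty, zero_mul]
        exact zero_le
    · rw [Set.indicator_of_notMem (by simpa using ht)]
      exact zero_le
  calc _ ≤ ENNReal.ofReal r * ∫⁻ t in Set.Ioc 0 δ, ENNReal.ofReal (K * t ^ (r - 1 - α)) := by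
        gcongr
    _ = _ := by
        rw [← ofReal_integral_eq_lintegral_ofReal hint, hval, ← ENNReal.ofReal_mul hr0.le]
        · ring_nf
        · filter_upwards [ae_restrict_mem measurableSet_Ioc] with t ht
          exact mul_nonneg hK (Real.rpow_nonneg ht.1.le _)

/-- The `r`-th moment of a function with tails of order `α > r`. -/
lemma lintegral_rpow_le_of_tail {Ω : Type*} [MeasurableSpace Ω] {μ : Measure Ω}
    [IsProbabilityMeasure μ] {f : Ω → ℝ} {K N α r : ℝ} (hf : Measurable f) (hf0 : 0 ≤ f)
    (hK : 0 ≤ K) (hN : 0 < N) (hr0 : 0 < r) (hr : r < α)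
    (htail : ∀ t > 0, μ {x | t < f x} ≤ ENNReal.ofReal (K * (N / t) ^ α)) :
    ∫⁻ x, ENNReal.ofReal (f x ^ r) ∂μ ≤ ENNReal.ofReal ((1 + r * K / (α - r)) * N ^ r) := by
  rw [lintegral_rpow_eq_lintegral_meas_lt_mul μ (Filter.Eventually.of_forall hf0)
    hf.aemeasurable hr0, ← Set.Ioc_union_Ioi_eq_Ioi hN.le,
    lintegral_union measurableSet_Ioi (Set.Ioc_disjoint_Ioi le_rfl)]
  have hint₁ : IntegrableOn (fun t : ℝ => t ^ (r - 1)) (Set.Ioc 0 N) := by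
    rw [← intervalIntegrable_iff_integrableOn_Ioc_of_le hN.le]
    exact intervalIntegral.intervalIntegrable_rpow' (by linarith)
  have hval₁ : ∫ t in Set.Ioc 0 N, t ^ (r - 1) = N ^ r / r := by
    rw [← intervalIntegral.integral_of_le hN.le, integral_rpow (Or.inl (by linarith))]
    rw [sub_add_cancel, Real.zero_rpow hr0.ne', sub_zero]
  have hint₂ : IntegrableOn (fun t : ℝ => K * N ^ α * t ^ (r - 1 - α)) (Set.Ioi N) :=
    (integrableOn_Ioi_rpow_of_lt (by linarith) hN).const_mul _
  have hval₂ : ∫ t in Set.Ioi N, K * N ^ α * t ^ (r - 1 - α) = K / (α - r) * N ^ r := by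
    rw [integral_const_mul, integral_Ioi_rpow_of_lt (by linarith) hN,
      show r - 1 - α + 1 = r - α by ring, Real.rpow_sub hN]
    have := (Real.rpow_pos_of_pos hN α).ne'
    have h1 : α - r ≠ 0 := by linarith
    have h2 : r - α ≠ 0 := by linarith
    rw [show r - α = -(α - r) by ring, neg_div_neg_eq]
    field_simp
  have h₁ : ∫⁻ t in Set.Ioc 0 N, μ {a | t < f a} * ENNReal.ofReal (t ^ (r - 1)) ≤
      ENNReal.ofReal (N ^ r / r) := by
    rw [← hval₁, ofReal_integral_eq_lintegral_ofReal hint₁]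
    · refine lintegral_mono fun t => ?_
      exact (mul_le_mul_left prob_le_one _).trans_eq (one_mul _)
    · filter_upwards [ae_restrict_mem measurableSet_Ioc] with t ht
      exact Real.rpow_nonneg ht.1.le _
  have h₂ : ∫⁻ t in Set.Ioi N, μ {a | t < f a} * ENNReal.ofReal (t ^ (r - 1)) ≤
      ENNReal.ofReal (K / (α - r) * N ^ r) := by
    rw [← hval₂, ofReal_integral_eq_lintegral_ofReal hint₂]
    · refine setLIntegral_mono' measurableSet_Ioi fun t ht => ?_
      have ht0 : 0 < t := hN.trans ht
      calc μ {a | t < f a} * ENNReal.ofReal (t ^ (r - 1))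
          ≤ ENNReal.ofReal (K * (N / t) ^ α) * ENNReal.ofReal (t ^ (r - 1)) := by
            gcongr
            exact htail t ht0
        _ = _ := by
            rw [← ENNReal.ofReal_mul (by positivity), Real.div_rpow hN.le ht0.le,
              Real.rpow_sub ht0 (r - 1)]
            ring_nf
    · filter_upwards [ae_restrict_mem measurableSet_Ioi] with t ht
      have ht0 : 0 < t := hN.trans ht
      positivity
  have hαr : 0 < α - r := by linarith
  calc _ ≤ ENNReal.ofReal r *
        (ENNReal.ofReal (N ^ r / r) + ENNReal.ofReal (K / (α - r) * N ^ r)) := by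
        gcongr
    _ = _ := by
        rw [← ENNReal.ofReal_add (by positivity) (by positivity), ← ENNReal.ofReal_mul hr0.le]
        congr 1
        field_simp

/-- A law whose characteristic function satisfies `‖1 - φ t‖ ≤ B |t| ^ α` has tails of order `α`. -/
lemma measureReal_abs_gt_le_of_charFun {ν : Measure ℝ} [IsProbabilityMeasure ν] {α B : ℝ}
    (hα : 0 ≤ α) (hB : 0 ≤ B) (h : ∀ t, ‖1 - charFun ν t‖ ≤ B * |t| ^ α) {s : ℝ} (hs : 0 < s) :
    ν.real {x | s < |x|} ≤ 2 * B * 2 ^ α * s ^ (-α) := by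
  refine (measureReal_abs_gt_le_integral_charFun hs).trans ?_
  have h1 : ‖∫ t in (-2 * s⁻¹)..(2 * s⁻¹), 1 - charFun ν t‖ ≤
      B * (2 * s⁻¹) ^ α * |2 * s⁻¹ - -2 * s⁻¹| := by
    refine intervalIntegral.norm_integral_le_of_norm_le_const fun t ht => (h t).trans ?_
    have hs' : (0:ℝ) < 2 * s⁻¹ := by positivity
    rw [Set.uIoc_of_le (by linarith)] at ht
    gcongr
    exact abs_le.2 ⟨by linarith [ht.1], ht.2⟩
  calc _ ≤ 2⁻¹ * s * (B * (2 * s⁻¹) ^ α * |2 * s⁻¹ - -2 * s⁻¹|) := by gcongr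
    _ = _ := by
      rw [show 2 * s⁻¹ - -2 * s⁻¹ = 4 * s⁻¹ by ring, abs_of_pos (by positivity),
        Real.mul_rpow (by norm_num) (by positivity), Real.inv_rpow hs.le, Real.rpow_neg hs.le]
      field_simp
      ring

/-- A law with tails of order at most `α < 2` whose characteristic function satisfies
`b t ^ α ≤ 1 - Re φ t` near zero also has tails of order at least `α`. -/
lemma exists_le_measureReal_abs_gt_of_charFun {α K b : ℝ} (hα : 0 < α) (hα2 : α < 2)
    (hK : 0 < K) (hb : 0 < b) :
    ∃ k s₀ : ℝ, 0 < k ∧ 0 < s₀ ∧ ∀ (ν : Measure ℝ) [IsProbabilityMeasure ν],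
      (∀ s > 0, ν.real {x | s < |x|} ≤ K * s ^ (-α)) →
      (∀ t, 0 < t → t ≤ 1 → b * t ^ α ≤ 1 - (charFun ν t).re) →
      ∀ s, s₀ ≤ s → k * s ^ (-α) ≤ ν.real {x | s < |x|} := by
  obtain ⟨δ, hδ0, hδ⟩ : ∃ δ : ℝ, 0 < δ ∧ K / (2 - α) * δ ^ (2 - α) = b / 2 := by
    have h2 : 0 < 2 - α := by linarith
    refine ⟨(b / 2 * ((2 - α) / K)) ^ (2 - α)⁻¹, by positivity, ?_⟩
    rw [Real.rpow_inv_rpow (by positivity) h2.ne']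
    field_simp
  refine ⟨b / 4 * δ ^ α, δ, by positivity, hδ0, fun ν _ htail hφ s hs => ?_⟩
  have hs0 : 0 < s := hδ0.trans_le hs
  set t := δ / s with ht
  have ht0 : 0 < t := by positivity
  have ht1 : t ≤ 1 := (div_le_one hs0).2 hs
  have hcosint : Integrable (fun x : ℝ => Real.cos (t * x)) ν :=
    Integrable.of_bound (by fun_prop) 1 (Filter.Eventually.of_forall fun x => by
      simpa using Real.abs_cos_le_one _)
  have hre : (charFun ν t).re = ∫ x, Real.cos (t * x) ∂ν := by
    rw [charFun_apply_real, ← RCLike.re_eq_complex_re, ← integral_re]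
    · refine integral_congr_ae (Filter.Eventually.of_forall fun x => ?_)
      simp only [RCLike.re_eq_complex_re]
      rw [show (t : ℂ) * x * Complex.I = ((t * x : ℝ) : ℂ) * Complex.I by push_cast; ring,
        Complex.exp_ofReal_mul_I_re]
    · refine Integrable.of_bound (by fun_prop) 1 (Filter.Eventually.of_forall fun x => ?_)
      rw [show (t : ℂ) * x * Complex.I = ((t * x : ℝ) : ℂ) * Complex.I by push_cast; ring,
        Complex.norm_exp_ofReal_mul_I]
  have hmeas : Measurable fun x : ℝ => min |x| s ^ (2 : ℝ) := by fun_prop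
  have hminint : Integrable (fun x : ℝ => min |x| s ^ (2 : ℝ)) ν := by
    refine Integrable.of_bound hmeas.aestronglyMeasurable (s ^ (2:ℝ))
      (Filter.Eventually.of_forall fun x => ?_)
    have : 0 ≤ min |x| s := le_min (abs_nonneg _) hs0.le
    rw [Real.norm_of_nonneg (by positivity)]
    gcongr
    exact min_le_right _ _
  have hmin : ∫ x, min |x| s ^ (2 : ℝ) ∂ν ≤ 2 * K / (2 - α) * s ^ (2 - α) := by
    have h2 : 0 < 2 - α := by linarith
    rw [integral_eq_lintegral_of_nonneg_ae _ hmeas.aestronglyMeasurable]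
    · refine ENNReal.toReal_le_of_le_ofReal (by positivity) ?_
      refine lintegral_min_rpow_le measurable_norm (fun x => abs_nonneg x) hK.le hα hα2 hs0
        fun u hu => ?_
      exact (ENNReal.le_ofReal_iff_toReal_le (measure_ne_top _ _) (by positivity)).2 (htail u hu)
    · exact Filter.Eventually.of_forall fun x =>
        Real.rpow_nonneg (le_min (abs_nonneg _) hs0.le) _
  have hset : MeasurableSet {x : ℝ | s < |x|} := measurableSet_lt measurable_const (by fun_prop)
  have hpt : ∀ x : ℝ, 1 - Real.cos (t * x) ≤
      t ^ 2 / 2 * min |x| s ^ (2 : ℝ) + 2 * {x : ℝ | s < |x|}.indicator 1 x := by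
    intro x
    by_cases hx : s < |x|
    · rw [Set.indicator_of_mem (show x ∈ {x : ℝ | s < |x|} from hx)]
      have : 0 ≤ min |x| s := le_min (abs_nonneg _) hs0.le
      have : 0 ≤ t ^ 2 / 2 * min |x| s ^ (2 : ℝ) := by positivity
      simp only [Pi.one_apply]
      linarith [Real.neg_one_le_cos (t * x)]
    · rw [Set.indicator_of_notMem (show x ∉ {x : ℝ | s < |x|} from hx), min_eq_left (not_lt.1 hx),
        Real.rpow_two, sq_abs]
      linarith [Real.one_sub_sq_div_two_le_cos (x := t * x), mul_pow t x 2]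
  have hind : Integrable ({x : ℝ | s < |x|}.indicator (1 : ℝ → ℝ)) ν :=
    (integrable_const (1:ℝ)).indicator hset
  have key : 1 - (charFun ν t).re ≤
      t ^ 2 / 2 * (2 * K / (2 - α) * s ^ (2 - α)) + 2 * ν.real {x | s < |x|} := by
    calc 1 - (charFun ν t).re = ∫ x, (1 - Real.cos (t * x)) ∂ν := by
          rw [integral_sub (integrable_const _) hcosint, hre]; simp
      _ ≤ ∫ x, (t ^ 2 / 2 * min |x| s ^ (2 : ℝ) + 2 * {x : ℝ | s < |x|}.indicator 1 x) ∂ν :=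
          integral_mono ((integrable_const _).sub hcosint)
            ((hminint.const_mul _).add (hind.const_mul _)) hpt
      _ = t ^ 2 / 2 * ∫ x, min |x| s ^ (2 : ℝ) ∂ν + 2 * ν.real {x | s < |x|} := by
          rw [integral_add (hminint.const_mul _) (hind.const_mul _), integral_const_mul,
            integral_const_mul, integral_indicator_one hset]
      _ ≤ _ := by gcongr
  have e1 : t ^ 2 / 2 * (2 * K / (2 - α) * s ^ (2 - α)) = b / 2 * t ^ α := by
    rw [← hδ, ht, Real.div_rpow hδ0.le hs0.le, Real.rpow_sub hs0, Real.rpow_sub hδ0,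
      Real.rpow_two, Real.rpow_two]
    field_simp
  have e2 : b / 4 * δ ^ α * s ^ (-α) = b / 4 * t ^ α := by
    rw [ht, Real.div_rpow hδ0.le hs0.le, Real.rpow_neg hs0.le]
    field_simp
  have := hφ t ht0 ht1
  rw [e1] at key
  rw [e2]
  linarith

lemma IsStableLaw.map_inv_mul {α σ β : ℝ} {ν : Measure ℝ} (h : IsStableLaw α σ β ν) :
    IsStableLaw α 1 β (ν.map (σ⁻¹ * ·)) := by
  obtain ⟨hσ, hβ, hφ⟩ := h
  refine ⟨one_pos, hβ, fun t => ?_⟩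
  have hsign : Real.sign (σ⁻¹ * t) = Real.sign t := by
    rcases lt_trichotomy t 0 with ht | rfl | ht
    · rw [Real.sign_of_neg ht, Real.sign_of_neg (mul_neg_of_pos_of_neg (inv_pos.2 hσ) ht)]
    · simp
    · rw [Real.sign_of_pos ht, Real.sign_of_pos (by positivity)]
  rw [charFun_map_mul, hφ, hsign, abs_mul, abs_of_pos (inv_pos.2 hσ),
    mul_inv_cancel_left₀ hσ.ne', one_mul]

lemma IsStableLaw.norm_one_sub_charFun_le {α β : ℝ} {ν : Measure ℝ} [IsProbabilityMeasure ν]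
    (h : IsStableLaw α 1 β ν) (t : ℝ) :
    ‖1 - charFun ν t‖ ≤ 2 * (1 + |Real.tan (Real.pi * α / 2)|) * |t| ^ α := by
  obtain ⟨-, hβ, hφ⟩ := h
  set z : ℂ := -(((1 * |t|) ^ α : ℝ) : ℂ) *
        (1 - Complex.I * ((β * Real.sign t * Real.tan (Real.pi * α / 2) : ℝ) : ℂ)) with hz
  have hsign : |Real.sign t| ≤ 1 := by
    rcases Real.sign_apply_eq t with h | h | h <;> simp [h]
  have hznorm : ‖z‖ ≤ (1 + |Real.tan (Real.pi * α / 2)|) * |t| ^ α := by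
    rw [hz, norm_mul, norm_neg, Complex.norm_real, one_mul, Real.norm_of_nonneg (by positivity),
      mul_comm]
    gcongr
    refine (norm_sub_le _ _).trans ?_
    rw [norm_one, norm_mul, Complex.norm_I, one_mul, Complex.norm_real, Real.norm_eq_abs, abs_mul,
      abs_mul]
    gcongr
    exact mul_le_of_le_one_left (abs_nonneg _) (mul_le_one₀ hβ (abs_nonneg _) hsign)
  have h2 : ‖1 - charFun ν t‖ ≤ 2 * ‖z‖ := by
    by_cases hz1 : ‖z‖ ≤ 1
    · rw [norm_sub_rev, hφ t]
      exact Complex.norm_exp_sub_one_le hz1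
    · exact norm_one_sub_charFun_le_two.trans (by linarith)
  linarith

lemma IsStableLaw.half_rpow_le_one_sub_re_charFun {α β : ℝ} {ν : Measure ℝ} (hα : 0 ≤ α)
    (h : IsStableLaw α 1 β ν) {t : ℝ} (ht0 : 0 < t) (ht1 : t ≤ 1) :
    1 / 2 * t ^ α ≤ 1 - (charFun ν t).re := by
  obtain ⟨-, -, hφ⟩ := h
  have hx0 : 0 ≤ t ^ α := by positivity
  have hx1 : t ^ α ≤ 1 := Real.rpow_le_one ht0.le ht1 hα
  have hre : (charFun ν t).re ≤ Real.exp (-t ^ α) := by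
    refine (Complex.re_le_norm _).trans_eq ?_
    rw [hφ, Complex.norm_exp]
    congr 1
    rw [← Complex.ofReal_neg, Complex.re_ofReal_mul, one_mul, abs_of_pos ht0,
      Complex.sub_re, Complex.one_re, Complex.I_mul_re, Complex.ofReal_im, neg_zero, sub_zero,
      mul_one]
  have hexp : Real.exp (-t ^ α) ≤ 1 - 1 / 2 * t ^ α := by
    rw [Real.exp_neg, inv_le_comm₀ (Real.exp_pos _) (by linarith)]
    refine le_trans ?_ (Real.add_one_le_exp (t ^ α))
    rw [inv_le_iff_one_le_mul₀ (by linarith)]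
    nlinarith
  linarith

/-- The tails of an `α`-stable law of scale `σ` are of order `(σ / s) ^ α`, uniformly in the
skewness. -/
lemma IsStableLaw.exists_tail_bounds {α : ℝ} (hα : 0 < α) (hα2 : α < 2) :
    ∃ K k s₀ : ℝ, 0 < K ∧ 0 < k ∧ 0 < s₀ ∧
      ∀ (ν : Measure ℝ) [IsProbabilityMeasure ν] (σ β : ℝ), IsStableLaw α σ β ν →
        (∀ s > 0, ν.real {x | s < |x|} ≤ K * (σ / s) ^ α) ∧
        ∀ s, s₀ * σ ≤ s → k * (σ / s) ^ α ≤ ν.real {x | s < |x|} := by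
  set B : ℝ := 2 * (1 + |Real.tan (Real.pi * α / 2)|)
  have hB : 0 < B := by positivity
  obtain ⟨k, s₀, hk, hs₀, hlow⟩ := exists_le_measureReal_abs_gt_of_charFun hα hα2
    (show 0 < 2 * B * 2 ^ α by positivity) (show (0:ℝ) < 1 / 2 by norm_num)
  refine ⟨2 * B * 2 ^ α, k, s₀, by positivity, hk, hs₀, fun ν _ σ β h => ?_⟩
  have hσ := h.1
  have hmeas : Measurable fun x : ℝ => σ⁻¹ * x := by fun_prop
  have : IsProbabilityMeasure (ν.map (σ⁻¹ * ·)) :=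
    Measure.isProbabilityMeasure_map hmeas.aemeasurable
  have h1 := h.map_inv_mul
  have hup : ∀ s > 0, (ν.map (σ⁻¹ * ·)).real {x | s < |x|} ≤ 2 * B * 2 ^ α * s ^ (-α) :=
    fun s hs => measureReal_abs_gt_le_of_charFun hα.le hB.le h1.norm_one_sub_charFun_le hs
  have hset : ∀ s, (ν.map (σ⁻¹ * ·)).real {x | s / σ < |x|} = ν.real {x | s < |x|} := by
    intro s
    rw [map_measureReal_apply hmeas (measurableSet_lt measurable_const (by fun_prop))]
    congr 1
    ext x
    change s / σ < |σ⁻¹ * x| ↔ s < |x|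
    rw [abs_mul, abs_inv, abs_of_pos hσ, div_eq_inv_mul]
    exact mul_lt_mul_iff_of_pos_left (inv_pos.2 hσ)
  have hpow : ∀ s, 0 < s → (s / σ) ^ (-α) = (σ / s) ^ α := by
    intro s hs
    rw [Real.rpow_neg (by positivity), ← Real.inv_rpow (by positivity), inv_div]
  refine ⟨fun s hs => ?_, fun s hs => ?_⟩
  · rw [← hset, ← hpow s hs]
    exact hup _ (by positivity)
  · have hs' : 0 < s := (mul_pos hs₀ hσ).trans_le hs
    rw [← hset, ← hpow s hs']
    exact hlow _ hup (fun t ht0 ht1 => h1.half_rpow_le_one_sub_re_charFun hα.le ht0 ht1) _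
      ((le_div_iff₀ hσ).2 hs)

section EllNorm

variable {ι : Type*} [Fintype ι] {r : ℝ}

lemma ellNorm_eq_sum (hr : 0 < r) (x : ι → ℝ) : ellNorm r x = (∑ i, |x i| ^ r) ^ (1 / r) := by
  have h : (ENNReal.ofReal r).toReal = r := ENNReal.toReal_ofReal hr.le
  rw [ellNorm, PiLp.norm_eq_sum (by rwa [h]), h]
  rfl

lemma ellNorm_nonneg (hr : 0 < r) (x : ι → ℝ) : 0 ≤ ellNorm r x := by
  rw [ellNorm_eq_sum hr]
  positivity

lemma ellNorm_rpow (hr : 0 < r) (x : ι → ℝ) : ellNorm r x ^ r = ∑ i, |x i| ^ r := by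
  rw [ellNorm_eq_sum hr, one_div, Real.rpow_inv_rpow (by positivity) hr.ne']

lemma abs_le_ellNorm (hr : 0 < r) (x : ι → ℝ) (i : ι) : |x i| ≤ ellNorm r x := by
  rw [← Real.rpow_le_rpow_iff (abs_nonneg _) (ellNorm_nonneg hr x) hr, ellNorm_rpow hr]
  exact Finset.single_le_sum (f := fun i => |x i| ^ r) (fun j _ => by positivity)
    (Finset.mem_univ i)

lemma ellNorm_mono (hr : 0 < r) {x y : ι → ℝ} (h : ∀ i, |x i| ≤ |y i|) :
    ellNorm r x ≤ ellNorm r y := by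
  rw [ellNorm_eq_sum hr, ellNorm_eq_sum hr]
  refine Real.rpow_le_rpow (by positivity) (Finset.sum_le_sum fun i _ => ?_) (by positivity)
  exact Real.rpow_le_rpow (abs_nonneg _) (h i) hr.le

lemma ellNorm_const_mul (hr : 0 < r) {c : ℝ} (hc : 0 ≤ c) (x : ι → ℝ) :
    ellNorm r (fun i => c * x i) = c * ellNorm r x := by
  rw [ellNorm_eq_sum hr, ellNorm_eq_sum hr]
  simp_rw [abs_mul, abs_of_nonneg hc, Real.mul_rpow hc (abs_nonneg _)]
  rw [← Finset.mul_sum, Real.mul_rpow (by positivity) (by positivity), one_div,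
    Real.rpow_rpow_inv hc hr.ne']

lemma measurable_ellNorm {Ω : Type*} [MeasurableSpace Ω] (hr : 0 < r) {f : ι → Ω → ℝ}
    (hf : ∀ i, Measurable (f i)) : Measurable fun ω => ellNorm r fun i => f i ω := by
  simp_rw [ellNorm_eq_sum hr]
  fun_prop

end EllNorm

section Maximum

variable {ι Ω : Type*} {X : ι → Ω → ℝ} {b : ι → ℝ}

lemma iSup_abs_mul_nonneg (ω : Ω) : 0 ≤ ⨆ i, |b i * X i ω| :=
  Real.iSup_nonneg fun _ => abs_nonneg _

lemma abs_mul_le_iSup [Finite ι] (ω : Ω) (i : ι) : |b i * X i ω| ≤ ⨆ i, |b i * X i ω| :=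
  le_ciSup (Finite.bddAbove_range fun i => |b i * X i ω|) i

variable [MeasurableSpace Ω] {μ : Measure Ω}

lemma measurable_iSup_abs_mul [Countable ι] (hX : ∀ i, Measurable (X i)) :
    Measurable fun ω => ⨆ i, |b i * X i ω| :=
  Measurable.iSup fun i => (measurable_norm.comp ((hX i).const_mul (b i)))

lemma measureReal_abs_mul_gt {i : ι} (hb : b i ≠ 0) (t : ℝ) :
    μ.real {ω | t < |b i * X i ω|} = μ.real {ω | t / |b i| < |X i ω|} := by
  congr 1
  ext ω
  change t < |b i * X i ω| ↔ t / |b i| < |X i ω|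
  rw [abs_mul, div_lt_iff₀' (abs_pos.2 hb)]

variable [Fintype ι] [IsProbabilityMeasure μ] {α K k σ s₀ : ℝ}

lemma measure_iSup_abs_mul_gt_le (hα : 0 < α) (hK : 0 ≤ K) (hσ : 0 < σ)
    (htail : ∀ i, ∀ s > 0, μ.real {ω | s < |X i ω|} ≤ K * (σ / s) ^ α) {t : ℝ} (ht : 0 < t) :
    μ {ω | t < ⨆ i, |b i * X i ω|} ≤ ENNReal.ofReal (K * (σ * ellNorm α b / t) ^ α) := by
  have hN := ellNorm_nonneg hα b
  rw [ENNReal.le_ofReal_iff_toReal_le (measure_ne_top _ _) (by positivity)]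
  have hsub : {ω | t < ⨆ i, |b i * X i ω|} ⊆ ⋃ i, {ω | t < |b i * X i ω|} := by
    intro ω (hω : t < _)
    by_contra hcon
    have hle : ∀ i, |b i * X i ω| ≤ t := fun i => not_lt.1 fun hi => hcon (Set.mem_iUnion.2 ⟨i, hi⟩)
    exact absurd hω (not_lt.2 (Real.iSup_le hle ht.le))
  calc μ.real {ω | t < ⨆ i, |b i * X i ω|}
      ≤ μ.real (⋃ i, {ω | t < |b i * X i ω|}) := measureReal_mono hsub
    _ ≤ ∑ i, μ.real {ω | t < |b i * X i ω|} := measureReal_iUnion_fintype_le _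
    _ ≤ ∑ i, K * (σ / t) ^ α * |b i| ^ α := by
        refine Finset.sum_le_sum fun i _ => ?_
        by_cases hb : b i = 0
        · have : {ω | t < |b i * X i ω|} = ∅ :=
            Set.eq_empty_of_forall_notMem fun ω (hω : t < _) => by
              rw [hb, zero_mul, abs_zero] at hω
              exact hω.not_gt ht
          rw [this, measureReal_empty]
          positivity
        · have hb' := abs_pos.2 hb
          rw [measureReal_abs_mul_gt hb]
          refine (htail i _ (by positivity)).trans_eq ?_
          rw [mul_assoc, ← Real.mul_rpow (by positivity) (by positivity), div_div_eq_mul_div,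
            div_mul_eq_mul_div]
    _ = K * (σ * ellNorm α b / t) ^ α := by
        rw [← Finset.mul_sum, ← ellNorm_rpow hα, mul_assoc,
          ← Real.mul_rpow (by positivity) (by positivity), div_mul_eq_mul_div]

/-- Moments of order `r < α` of a weighted maximum of variables with tails of order `α`. -/
lemma integrable_iSup_rpow_and_integral_le (hX : ∀ i, Measurable (X i)) (hα : 0 < α) (hK : 0 ≤ K)
    (hσ : 0 < σ) (htail : ∀ i, ∀ s > 0, μ.real {ω | s < |X i ω|} ≤ K * (σ / s) ^ α)
    {r : ℝ} (hr0 : 0 < r) (hr : r < α) :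
    Integrable (fun ω => (⨆ i, |b i * X i ω|) ^ r) μ ∧
      ∫ ω, (⨆ i, |b i * X i ω|) ^ r ∂μ ≤ (1 + r * K / (α - r)) * (σ * ellNorm α b) ^ r := by
  have hN := ellNorm_nonneg hα b
  have hαr : 0 < α - r := by linarith
  have hmeas : Measurable fun ω => (⨆ i, |b i * X i ω|) ^ r :=
    (measurable_iSup_abs_mul hX).pow_const r
  have hnn : ∀ ω, 0 ≤ (⨆ i, |b i * X i ω|) ^ r :=
    fun ω => Real.rpow_nonneg (iSup_abs_mul_nonneg ω) r
  have hle : ∫⁻ ω, ENNReal.ofReal ((⨆ i, |b i * X i ω|) ^ r) ∂μ ≤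
      ENNReal.ofReal ((1 + r * K / (α - r)) * (σ * ellNorm α b) ^ r) := by
    rcases hN.eq_or_lt with h0 | hpos
    · have hb : ∀ i, b i = 0 := fun i => abs_nonpos_iff.1 ((abs_le_ellNorm hα b i).trans h0.symm.le)
      have hM : ∀ ω, ⨆ i, |b i * X i ω| = 0 := fun ω =>
        le_antisymm (Real.iSup_le (fun i => by simp [hb i]) le_rfl) (iSup_abs_mul_nonneg ω)
      simp_rw [hM, Real.zero_rpow hr0.ne', ENNReal.ofReal_zero, lintegral_zero]
      exact zero_le
    · exact lintegral_rpow_le_of_tail (measurable_iSup_abs_mul hX) iSup_abs_mul_nonneg hK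
        (mul_pos hσ hpos) hr0 hr fun t ht => measure_iSup_abs_mul_gt_le hα hK hσ htail ht
  constructor
  · refine ⟨hmeas.aestronglyMeasurable, ?_⟩
    rw [hasFiniteIntegral_iff_ofReal (Filter.Eventually.of_forall hnn)]
    exact hle.trans_lt ENNReal.ofReal_lt_top
  · rw [integral_eq_lintegral_of_nonneg_ae (Filter.Eventually.of_forall hnn)
      hmeas.aestronglyMeasurable]
    exact ENNReal.toReal_le_of_le_ofReal (by positivity) hle

/-- Lower bound for the expected weighted maximum of independent variables with tails of
order `α`. -/
lemma le_integral_iSup_abs_mul (hX : ∀ i, Measurable (X i)) (hind : iIndepFun X μ) (hα : 0 < α)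
    (hσ : 0 < σ) (hs₀ : 0 < s₀)
    (htail : ∀ i s, s₀ * σ ≤ s → k * (σ / s) ^ α ≤ μ.real {ω | s < |X i ω|})
    (hint : Integrable (fun ω => ⨆ i, |b i * X i ω|) μ) :
    s₀ * (1 - Real.exp (-(k * s₀ ^ (-α)))) * (σ * ellNorm α b) ≤
      ∫ ω, ⨆ i, |b i * X i ω| ∂μ := by
  set N := ellNorm α b with hNdef
  rcases (ellNorm_nonneg hα b).eq_or_lt with h0 | hN
  · rw [hNdef, ← h0, mul_zero, mul_zero]
    exact integral_nonneg iSup_abs_mul_nonneg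
  rw [← hNdef] at hN
  set s := s₀ * (σ * N) with hs
  have hs0 : 0 < s := by positivity
  have hmset : ∀ i, MeasurableSet {ω | s < |b i * X i ω|} := fun i =>
    measurableSet_lt measurable_const (measurable_norm.comp ((hX i).const_mul (b i)))
  have hp : ∀ i, k * s₀ ^ (-α) * (|b i| ^ α / N ^ α) ≤ μ.real {ω | s < |b i * X i ω|} := by
    intro i
    by_cases hb : b i = 0
    · rw [hb, abs_zero, Real.zero_rpow hα.ne', zero_div, mul_zero]
      exact measureReal_nonneg
    · have hb' := abs_pos.2 hb
      have hbN : |b i| ≤ N := abs_le_ellNorm hα b i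
      rw [measureReal_abs_mul_gt hb]
      refine le_trans (le_of_eq ?_) (htail i _ ?_)
      · rw [mul_assoc, Real.rpow_neg hs₀.le, ← Real.inv_rpow hs₀.le,
          ← Real.div_rpow hb'.le hN.le, ← Real.mul_rpow (by positivity) (by positivity)]
        congr 2
        rw [hs]
        field_simp
      · rw [le_div_iff₀ hb', hs, mul_assoc]
        gcongr
  have hsum : ∑ i, k * s₀ ^ (-α) * (|b i| ^ α / N ^ α) = k * s₀ ^ (-α) := by
    rw [← Finset.mul_sum, ← Finset.sum_div, ← ellNorm_rpow hα, ← hNdef,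
      div_self (Real.rpow_pos_of_pos hN α).ne', mul_one]
  have hprod : μ.real (⋂ i, {ω | s < |b i * X i ω|}ᶜ) ≤ Real.exp (-(k * s₀ ^ (-α))) := by
    have hcomap : ∀ i, MeasurableSet[MeasurableSpace.comap (X i) inferInstance]
        {ω | s < |b i * X i ω|}ᶜ := fun i =>
      ⟨{x | s < |b i * x|}ᶜ, (measurableSet_lt measurable_const (by fun_prop)).compl, rfl⟩
    rw [Measure.real, hind.meas_iInter hcomap, ENNReal.toReal_prod, ← hsum,
      ← Finset.sum_neg_distrib, Real.exp_sum]
    refine Finset.prod_le_prod (fun i _ => ENNReal.toReal_nonneg) fun i _ => ?_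
    change μ.real _ ≤ _
    rw [probReal_compl_eq_one_sub (hmset i)]
    have := Real.add_one_le_exp (-(k * s₀ ^ (-α) * (|b i| ^ α / N ^ α)))
    linarith [hp i]
  have hge : 1 - Real.exp (-(k * s₀ ^ (-α))) ≤ μ.real {ω | s ≤ ⨆ i, |b i * X i ω|} := by
    have hcompl : μ.real (⋂ i, {ω | s < |b i * X i ω|}ᶜ)ᶜ =
        1 - μ.real (⋂ i, {ω | s < |b i * X i ω|}ᶜ) :=
      probReal_compl_eq_one_sub (MeasurableSet.iInter fun i => (hmset i).compl)
    have hmono : μ.real (⋂ i, {ω | s < |b i * X i ω|}ᶜ)ᶜ ≤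
        μ.real {ω | s ≤ ⨆ i, |b i * X i ω|} := by
      refine measureReal_mono ?_
      rw [Set.compl_iInter]
      refine Set.iUnion_subset fun i ω hω => ?_
      rw [compl_compl] at hω
      exact (le_of_lt (show s < |b i * X i ω| from hω)).trans (abs_mul_le_iSup ω i)
    linarith
  calc s₀ * (1 - Real.exp (-(k * s₀ ^ (-α)))) * (σ * N)
      = s * (1 - Real.exp (-(k * s₀ ^ (-α)))) := by rw [hs]; ring
    _ ≤ s * μ.real {ω | s ≤ ⨆ i, |b i * X i ω|} := by gcongr
    _ ≤ ∫ ω, ⨆ i, |b i * X i ω| ∂μ :=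
      mul_meas_ge_le_integral_of_nonneg (Filter.Eventually.of_forall iSup_abs_mul_nonneg) hint s

end Maximum

lemma measureReal_map_abs_gt {Ω : Type*} [MeasurableSpace Ω] {μ : Measure Ω} {X : Ω → ℝ}
    (hX : Measurable X) (s : ℝ) :
    (μ.map X).real {x | s < |x|} = μ.real {ω | s < |X ω|} :=
  map_measureReal_apply hX (measurableSet_lt measurable_const (by fun_prop))

/-- Moments of a weighted maximum of `α`-stable variables. -/
lemma IsStableLaw.exists_integral_iSup_rpow_le {α r : ℝ} (hα2 : α < 2) (hr0 : 0 < r) (hr : r < α) :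
    ∃ C : ℝ, 0 < C ∧ ∀ {ι Ω : Type*} [Fintype ι] [MeasurableSpace Ω] (μ : Measure Ω)
      [IsProbabilityMeasure μ] (X : ι → Ω → ℝ) (σ β : ℝ), 0 < σ → (∀ i, Measurable (X i)) →
      (∀ i, IsStableLaw α σ β (μ.map (X i))) → ∀ b : ι → ℝ,
      Integrable (fun ω => (⨆ i, |b i * X i ω|) ^ r) μ ∧
        ∫ ω, (⨆ i, |b i * X i ω|) ^ r ∂μ ≤ C * (σ * ellNorm α b) ^ r := by
  have hα : 0 < α := hr0.trans hr
  have hαr : 0 < α - r := by linarith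
  obtain ⟨K, k, s₀, hK, -, -, h⟩ := IsStableLaw.exists_tail_bounds hα hα2
  refine ⟨1 + r * K / (α - r), by positivity, fun μ _ X σ β hσ hX hlaw b => ?_⟩
  refine integrable_iSup_rpow_and_integral_le hX hα hK.le hσ (fun i s hs => ?_) hr0 hr
  have := Measure.isProbabilityMeasure_map (μ := μ) (hX i).aemeasurable
  rw [← measureReal_map_abs_gt (hX i)]
  exact (h _ σ β (hlaw i)).1 s hs

/-- The expected weighted maximum of independent `α`-stable variables dominates the `ℓ_α`-norm of
the weights. -/
lemma IsStableLaw.exists_le_integral_iSup {α : ℝ} (hα1 : 1 < α) (hα2 : α < 2) :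
    ∃ c : ℝ, 0 < c ∧ ∀ {ι Ω : Type*} [Fintype ι] [MeasurableSpace Ω] (μ : Measure Ω)
      [IsProbabilityMeasure μ] (X : ι → Ω → ℝ) (σ β : ℝ), 0 < σ → (∀ i, Measurable (X i)) →
      iIndepFun X μ → (∀ i, IsStableLaw α σ β (μ.map (X i))) → ∀ b : ι → ℝ,
      c * (σ * ellNorm α b) ≤ ∫ ω, ⨆ i, |b i * X i ω| ∂μ := by
  have hα : 0 < α := by linarith
  obtain ⟨C, -, hC⟩ := IsStableLaw.exists_integral_iSup_rpow_le hα2 one_pos hα1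
  obtain ⟨K, k, s₀, -, hk, hs₀, h⟩ := IsStableLaw.exists_tail_bounds hα hα2
  refine ⟨s₀ * (1 - Real.exp (-(k * s₀ ^ (-α)))), ?_, fun μ _ X σ β hσ hX hind hlaw b => ?_⟩
  · have : 0 < k * s₀ ^ (-α) := by positivity
    exact mul_pos hs₀ (sub_pos.2 (by rw [Real.exp_lt_one_iff]; linarith))
  · refine le_integral_iSup_abs_mul hX hind hα hσ hs₀ (fun i s hs => ?_) ?_
    · have := Measure.isProbabilityMeasure_map (μ := μ) (hX i).aemeasurable
      rw [← measureReal_map_abs_gt (hX i)]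
      exact (h _ σ β (hlaw i)).2 s hs
    · simpa only [Real.rpow_one] using (hC μ X σ β hσ hX hlaw b).1

lemma maxAbs_eq_iSup {n m : ℕ} (a : Matrix (Fin n) (Fin m) ℝ) (x : Fin n → ℝ) (y : Fin m → ℝ) :
    maxAbs a x y = ⨆ j, |(⨆ i, |a i j * x i|) * y j| := by
  have hnn : ∀ j, 0 ≤ ⨆ i, |a i j * x i| := fun j => Real.iSup_nonneg fun _ => abs_nonneg _
  refine le_antisymm (Real.iSup_le (fun ij => ?_) (Real.iSup_nonneg fun _ => abs_nonneg _))
    (Real.iSup_le (fun j => ?_) (Real.iSup_nonneg fun _ => abs_nonneg _))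
  · refine le_trans ?_ (le_ciSup (Finite.bddAbove_range fun j => |(⨆ i, |a i j * x i|) * y j|) ij.2)
    rw [mul_right_comm, abs_mul, abs_mul (⨆ i, _), abs_of_nonneg (hnn _)]
    gcongr
    exact le_ciSup (Finite.bddAbove_range fun i => |a i ij.2 * x i|) ij.1
  · rw [abs_mul, abs_of_nonneg (hnn _), Real.iSup_mul_of_nonneg (abs_nonneg _)]
    refine Real.iSup_le (fun i => ?_) (Real.iSup_nonneg fun _ => abs_nonneg _)
    rw [← abs_mul, mul_right_comm]
    exact le_ciSup (Finite.bddAbove_range fun ij : Fin n × Fin m => |a ij.1 ij.2 * y ij.2 * x ij.1|)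
      (i, j)

section Interchange

variable {ι Ω : Type*} [Fintype ι] [MeasurableSpace Ω] {μ : Measure Ω} {r : ℝ} {f : ι → Ω → ℝ}

/-- Minkowski's inequality: the `ℓ_r`-norm of the means is at most the mean of the `ℓ_r`-norm. -/
lemma ellNorm_integral_le (hr : 1 ≤ r) (hf : ∀ i, Integrable (f i) μ) :
    ellNorm r (fun i => ∫ ω, f i ω ∂μ) ≤ ∫ ω, ellNorm r (fun i => f i ω) ∂μ := by
  have : Fact (1 ≤ ENNReal.ofReal r) := ⟨ENNReal.one_le_ofReal.2 hr⟩
  have h := norm_integral_le_integral_norm (μ := μ)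
    fun ω => WithLp.toLp (ENNReal.ofReal r) fun i => f i ω
  refine le_trans (le_of_eq ?_) h
  rw [ellNorm]
  congr 1
  ext i
  exact (eval_integral_piLp (f := fun ω => WithLp.toLp (ENNReal.ofReal r) fun i => f i ω) hf i).symm

/-- Jensen's inequality: the mean of the `ℓ_r`-norm is controlled by the `r`-th moments. -/
lemma integrable_ellNorm_and_integral_rpow_le [IsProbabilityMeasure μ] (hr : 1 ≤ r)
    (hf : ∀ i, Measurable (f i)) (hf0 : ∀ i ω, 0 ≤ f i ω)
    (hint : ∀ i, Integrable (fun ω => f i ω ^ r) μ) :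
    Integrable (fun ω => ellNorm r fun i => f i ω) μ ∧
      (∫ ω, ellNorm r (fun i => f i ω) ∂μ) ^ r ≤ ∑ i, ∫ ω, f i ω ^ r ∂μ := by
  have hr0 : 0 < r := by linarith
  have hpow : ∀ ω, ellNorm r (fun i => f i ω) ^ r = ∑ i, f i ω ^ r := fun ω => by
    rw [ellNorm_rpow hr0]
    simp_rw [abs_of_nonneg (hf0 _ _)]
  have hint' : Integrable (fun ω => ellNorm r (fun i => f i ω) ^ r) μ := by
    simp_rw [hpow]
    exact integrable_finsetSum _ fun i _ => hint i
  have hR : Integrable (fun ω => ellNorm r fun i => f i ω) μ := by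
    refine ((integrable_const (1 : ℝ)).add hint').mono'
      (measurable_ellNorm hr0 hf).aestronglyMeasurable (Filter.Eventually.of_forall fun ω => ?_)
    have h0 := ellNorm_nonneg hr0 fun i => f i ω
    rw [Real.norm_of_nonneg h0, Pi.add_apply]
    rcases le_total (ellNorm r fun i => f i ω) 1 with h1 | h1
    · linarith [Real.rpow_nonneg h0 r]
    · linarith [Real.self_le_rpow_of_one_le h1 hr]
  refine ⟨hR, ?_⟩
  rw [← integral_finsetSum _ fun i _ => hint i]
  simp_rw [← hpow]
  exact (convexOn_rpow hr).map_integral_le (Real.continuous_rpow_const hr0.le).continuousOn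
    isClosed_Ici (Filter.Eventually.of_forall fun ω => ellNorm_nonneg hr0 _) hR hint'

end Interchange

theorem mainTheorem1 (p q : ℝ) (hp : 1 < p) (hpq : p < q) (hq : q < 2) :
    ∃ c C : ℝ, 0 < c ∧ 0 < C ∧
      ∀ {Ω₁ Ω₂ : Type*} [MeasurableSpace Ω₁] [MeasurableSpace Ω₂]
        (P₁ : Measure Ω₁) (P₂ : Measure Ω₂) [IsProbabilityMeasure P₁] [IsProbabilityMeasure P₂]
        (n m : ℕ) (ξ : Fin n → Ω₁ → ℝ) (η : Fin m → Ω₂ → ℝ) (σ β τ γ : ℝ),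
        (∀ i, Measurable (ξ i)) → (∀ j, Measurable (η j)) →
        iIndepFun ξ P₁ → iIndepFun η P₂ →
        (∀ i, IsStableLaw q σ β (P₁.map (ξ i))) →
        (∀ j, IsStableLaw p τ γ (P₂.map (η j))) →
        ∀ a : Matrix (Fin n) (Fin m) ℝ,
          (∀ ω₁, Integrable (fun ω₂ => maxAbs a (fun i => ξ i ω₁) (fun j => η j ω₂)) P₂) ∧
          Integrable
            (fun ω₁ => ∫ ω₂, maxAbs a (fun i => ξ i ω₁) (fun j => η j ω₂) ∂P₂) P₁ ∧
          c * (σ * τ * ellNorm p (fun j => ellNorm q (fun i => a i j))) ≤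
            ∫ ω₁, ∫ ω₂, maxAbs a (fun i => ξ i ω₁) (fun j => η j ω₂) ∂P₂ ∂P₁ ∧
          ∫ ω₁, ∫ ω₂, maxAbs a (fun i => ξ i ω₁) (fun j => η j ω₂) ∂P₂ ∂P₁ ≤
            C * (σ * τ * ellNorm p (fun j => ellNorm q (fun i => a i j))) := by
  have hp0 : 0 < p := by linarith
  have hq0 : 0 < q := by linarith
  obtain ⟨cp, hcp, lowp⟩ := IsStableLaw.exists_le_integral_iSup hp (hpq.trans hq)
  obtain ⟨cq, hcq, lowq⟩ := IsStableLaw.exists_le_integral_iSup (hp.trans hpq) hq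
  obtain ⟨Cp, hCp, upp⟩ := IsStableLaw.exists_integral_iSup_rpow_le (hpq.trans hq) one_pos hp
  obtain ⟨Cq, hCq, upq⟩ := IsStableLaw.exists_integral_iSup_rpow_le hq hp0 hpq
  obtain ⟨_, -, upq₁⟩ := IsStableLaw.exists_integral_iSup_rpow_le hq one_pos (hp.trans hpq)
  simp only [Real.rpow_one] at upp upq₁
  refine ⟨cp * cq, Cp * Cq ^ (1 / p), by positivity, by positivity, ?_⟩
  intro Ω₁ Ω₂ _ _ P₁ P₂ _ _ n m ξ η σ β τ γ hξ hη hξi hηi hξl hηl a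
  rcases isEmpty_or_nonempty (Fin n × Fin m) with hempty | ⟨⟨i₀, j₀⟩⟩
  · have hmax : ∀ x y, maxAbs a x y = 0 := fun x y => Real.iSup_of_isEmpty _
    have hN : ellNorm p (fun j => ellNorm q (fun i => a i j)) = 0 := by
      have : ∀ j, ellNorm q (fun i => a i j) = 0 := fun j => by
        have : IsEmpty (Fin n) := ⟨fun i => hempty.false (i, j)⟩
        simp [ellNorm_eq_sum hq0, hq0.ne']
      simp [this, ellNorm_eq_sum hp0, hp0.ne', Real.zero_rpow]
    simp [hmax, hN]
  have hσ : 0 < σ := (hξl i₀).1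
  have hτ : 0 < τ := (hηl j₀).1
  set M : Fin m → Ω₁ → ℝ := fun j ω => ⨆ i, |a i j * ξ i ω| with hM
  have hM0 : ∀ j ω, 0 ≤ M j ω := fun j ω => iSup_abs_mul_nonneg (b := fun i => a i j) ω
  have hMmeas : ∀ j, Measurable (M j) := fun j => measurable_iSup_abs_mul (b := fun i => a i j) hξ
  set N := ellNorm p (fun j => ellNorm q (fun i => a i j)) with hN
  have hN0 : 0 ≤ N := ellNorm_nonneg hp0 _
  have hmax : ∀ ω₁ ω₂, maxAbs a (fun i => ξ i ω₁) (fun j => η j ω₂) = ⨆ j, |M j ω₁ * η j ω₂| :=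
    fun ω₁ ω₂ => maxAbs_eq_iSup _ _ _
  simp_rw [hmax]
  have hup := fun ω₁ => upp P₂ η τ γ hτ hη hηl fun j => M j ω₁
  have hlow := fun ω₁ => lowp P₂ η τ γ hτ hη hηi hηl fun j => M j ω₁
  have hMint : ∀ j, Integrable (M j) P₁ := fun j => (upq₁ P₁ ξ σ β hσ hξ hξl fun i => a i j).1
  have hMp := fun j => upq P₁ ξ σ β hσ hξ hξl fun i => a i j
  obtain ⟨hRint, hR⟩ := integrable_ellNorm_and_integral_rpow_le hp.le hMmeas hM0 fun j => (hMp j).1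
  have hRup : ∫ ω, ellNorm p (fun j => M j ω) ∂P₁ ≤ Cq ^ (1 / p) * (σ * N) := by
    rw [← Real.rpow_le_rpow_iff (integral_nonneg fun ω => ellNorm_nonneg hp0 _) (by positivity) hp0]
    refine hR.trans ((Finset.sum_le_sum fun j _ => (hMp j).2).trans_eq ?_)
    rw [Real.mul_rpow (by positivity) (by positivity), one_div, Real.rpow_inv_rpow hCq.le hp0.ne',
      Real.mul_rpow hσ.le hN0, hN, ellNorm_rpow hp0, ← Finset.mul_sum, Finset.mul_sum _ _ (σ ^ p)]
    congr 1
    refine Finset.sum_congr rfl fun j _ => ?_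
    rw [Real.mul_rpow hσ.le (ellNorm_nonneg hq0 _), abs_of_nonneg (ellNorm_nonneg hq0 _)]
  have hRlow : cq * (σ * N) ≤ ∫ ω, ellNorm p (fun j => M j ω) ∂P₁ := by
    refine le_trans ?_ (ellNorm_integral_le hp.le hMint)
    rw [← mul_assoc, hN, ← ellNorm_const_mul hp0 (by positivity)]
    refine ellNorm_mono hp0 fun j => ?_
    have h0 := ellNorm_nonneg hq0 fun i => a i j
    rw [abs_of_nonneg (by positivity), abs_of_nonneg (integral_nonneg (hM0 j)), mul_assoc]
    exact lowq P₁ ξ σ β hσ hξ hξi hξl fun i => a i j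
  have hjoint : Measurable fun ω : Ω₁ × Ω₂ => ⨆ j, |M j ω.1 * η j ω.2| :=
    Measurable.iSup fun j => measurable_norm.comp
      (((hMmeas j).comp measurable_fst).mul ((hη j).comp measurable_snd))
  have hIint : Integrable (fun ω₁ => ∫ ω₂, ⨆ j, |M j ω₁ * η j ω₂| ∂P₂) P₁ := by
    refine (hRint.const_mul (Cp * τ)).mono'
      hjoint.stronglyMeasurable.integral_prod_right.aestronglyMeasurable
      (Filter.Eventually.of_forall fun ω₁ => ?_)
    rw [Real.norm_of_nonneg (integral_nonneg fun ω₂ =>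
      iSup_abs_mul_nonneg (X := η) (b := fun j => M j ω₁) ω₂), mul_assoc]
    exact (hup ω₁).2
  refine ⟨fun ω₁ => (hup ω₁).1, hIint, ?_, ?_⟩
  · calc cp * cq * (σ * τ * N) = cp * τ * (cq * (σ * N)) := by ring
      _ ≤ cp * τ * ∫ ω, ellNorm p (fun j => M j ω) ∂P₁ := by gcongr
      _ = ∫ ω, cp * τ * ellNorm p (fun j => M j ω) ∂P₁ := (integral_const_mul _ _).symm
      _ ≤ _ := integral_mono (hRint.const_mul _) hIint fun ω₁ => by
          simpa only [mul_assoc] using hlow ω₁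
  · calc _ ≤ ∫ ω, Cp * τ * ellNorm p (fun j => M j ω) ∂P₁ :=
          integral_mono hIint (hRint.const_mul _) fun ω₁ => by
            simpa only [mul_assoc] using (hup ω₁).2
      _ = Cp * τ * ∫ ω, ellNorm p (fun j => M j ω) ∂P₁ := integral_const_mul _ _
      _ ≤ Cp * τ * (Cq ^ (1 / p) * (σ * N)) := by gcongr
      _ = _ := by ring
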